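/- Conventions. Let $\mathcal M\subseteq B(H)$ be a von Neumann algebra (a $*$-subalgebra equal to its double commutant). A $cp$-semigroup over $\mathbb N^3$ on $\mathcal M$ is a family $\Theta=\{\Theta_n\}_{n\in\mathbb N^3}$ of normal, contractive, completely positive linear maps $\mathcal M\to\mathcal M$ with $\Theta_0=\mathrm{id}$ and $\Theta_{m+n}=\Theta_m\circ\Theta_n$; it is an $e$-semigroup if every $\Theta_n$ is a (not necessarily unital) $*$-endomorphism. An $e$-dilation of $\Theta$ is a quadruple $(K,u,\mathcal R,\alpha)$ consisting of a Hilbert space $K$, an isometry $u:H\to K$, a von Neumann algebra $\mathcal R\subseteq B(K)$ with $u^*\mathcal R u=\mathcal M$, and an $e$-semigroup $\alpha=\{\alpha_n\}_{n\in\mathbb N^3}$ on $\mathcal R$ such that $\Theta_n(u^*au)=u^*\alpha_n(a)u$ for all $a\in\mathcal R$ and $n\in\mathbb N^3$. The $e$-dilation is minimal if the projection $uu^*$ belongs to $\mathcal R$ and has central support $I_K$ in $\mathcal R$, and $\mathcal R$ is the von Neumann algebra generated by $\bigcup_{n\in\mathbb N^3}\alpha_n(u\mathcal M u^*)$. Theorem.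 There exist a separable complex Hilbert space $H$ and pairwise commuting contractions $T_1,T_2,T_3\in B(H)$ such that the maps $$\Theta_n(a)=T_1^{n_1}T_2^{n_2}T_3^{n_3}\,a\,\bigl(T_1^{n_1}T_2^{n_2}T_3^{n_3}\bigr)^*,\qquad a\in B(H),\ n=(n_1,n_2,n_3)\in\mathbb N^3,$$ form a $cp$-semigroup $\Theta$ over $\mathbb N^3$ on $B(H)$ with the following two properties: (i) $\Theta$ has no $e$-dilation $(K,u,B(K),\alpha)$, for any Hilbert space $K$; (ii) $\Theta$ has no minimal $e$-dilation $(K,u,\mathcal R,\alpha)$, for any Hilbert space $K$ and any von Neumann algebra $\mathcal R\subseteq B(K)$. -/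

import Mathlib

open ContinuousLinearMap

universe u

noncomputable section

namespace VonNeumannAlgebra

variable {H : Type*} [NormedAddCommGroup H] [InnerProductSpace ℂ H] [CompleteSpace H]

instance instSMulMemClassComplex : SMulMemClass (VonNeumannAlgebra H) ℂ (H →L[ℂ] H) where
  smul_mem {M} c _ ha := M.toStarSubalgebra.smul_mem ha c

instance instIsClosedCoe (M : VonNeumannAlgebra H) : IsClosed (M : Set (H →L[ℂ] H)) := by
  rw [← M.centralizer_centralizer]
  exact Set.isClosed_centralizer _

/-- The positive elements of `M` (for the order inherited from bounded operators) are the elements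
`b⋆ b` with `b` in `M`, so that `M` is a C⋆-algebra with its usual order. -/
instance instStarOrderedRingCoe (M : VonNeumannAlgebra H) : StarOrderedRing M := by
  refine StarOrderedRing.of_nonneg_iff' (fun {x y} hxy z => ?_) (fun x => ⟨fun hx => ?_, ?_⟩)
  · have h : (x : H →L[ℂ] H) ≤ y := hxy
    exact (add_le_add_right h (z : H →L[ℂ] H) :)
  · have hx' : (0 : H →L[ℂ] H) ≤ x := hx
    have hmem : CFC.sqrt (x : H →L[ℂ] H) ∈ M := by
      rw [← SetLike.mem_coe, ← M.centralizer_centralizer]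
      intro y hy
      have hc : Commute (x : H →L[ℂ] H) y := hy x x.2
      exact (hc.cfcₙ_nnreal NNReal.sqrt).symm
    refine ⟨⟨CFC.sqrt (x : H →L[ℂ] H), hmem⟩, Subtype.ext ?_⟩
    have hs : star (CFC.sqrt (x : H →L[ℂ] H)) = CFC.sqrt (x : H →L[ℂ] H) :=
      (CFC.sqrt_nonneg (x : H →L[ℂ] H)).isSelfAdjoint
    change (x : H →L[ℂ] H) = star (CFC.sqrt (x : H →L[ℂ] H)) * CFC.sqrt (x : H →L[ℂ] H)
    rw [hs, CFC.sqrt_mul_sqrt_self _ hx']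
  · rintro ⟨s, rfl⟩
    exact (star_mul_self_nonneg (s : H →L[ℂ] H) :)

/-- The algebra `B(H)` of all bounded operators, as a von Neumann algebra. -/
def full (H : Type*) [NormedAddCommGroup H] [InnerProductSpace ℂ H] [CompleteSpace H] :
    VonNeumannAlgebra H where
  toStarSubalgebra := ⊤
  centralizer_centralizer' := by
    refine Set.Subset.antisymm (fun _ _ => trivial) ?_
    exact Set.subset_centralizer_centralizer

/-- A map between von Neumann algebras is normal if it preserves the suprema of upward directed,
bounded families of positive elements. (In a von Neumann algebra each such family has a
supremum.) -/
def IsNormalMap {K : Type*} [NormedAddCommGroup K] [InnerProductSpace ℂ K] [CompleteSpace K]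
    {M : VonNeumannAlgebra H} {N : VonNeumannAlgebra K} (φ : M → N) : Prop :=
  ∀ D : Set M, D.Nonempty → DirectedOn (· ≤ ·) D → (∀ d ∈ D, 0 ≤ d) →
    ∀ a : M, IsLUB D a → IsLUB (φ '' D) (φ a)

/-- `R` is the von Neumann algebra `W⋆(X)` generated by the set `X`. -/
def IsGeneratedBy (R : VonNeumannAlgebra H) (X : Set (H →L[ℂ] H)) : Prop :=
  IsLeast {N : VonNeumannAlgebra H | X ⊆ N} R

/-- `z` is the central support of `p` in `R`: the least projection in the centre of `R` that
dominates `p`. -/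
def IsCentralSupport (R : VonNeumannAlgebra H) (p z : H →L[ℂ] H) : Prop :=
  IsLeast {z : H →L[ℂ] H | IsStarProjection z ∧ z ∈ R ∧ z ∈ R.commutant ∧ z * p = p} z

end VonNeumannAlgebra

/-- A `cp`-semigroup over `S` on a von Neumann algebra `M`: a family of completely positive,
contractive and normal maps `Θ s : M → M` with `Θ 0 = id` and `Θ (s + t) = Θ s ∘ Θ t`. No
continuity in `s` is required. -/
structure CpSemigroup (S : Type*) [AddCommMonoid S] {H : Type*} [NormedAddCommGroup H]
    [InnerProductSpace ℂ H] [CompleteSpace H] (M : VonNeumannAlgebra H) where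
  toMap : S → CompletelyPositiveMap M M
  contractive' : ∀ s a, ‖toMap s a‖ ≤ ‖a‖
  normal' : ∀ s, VonNeumannAlgebra.IsNormalMap (toMap s)
  map_zero' : ∀ a, toMap 0 a = a
  map_add' : ∀ s t a, toMap (s + t) a = toMap s (toMap t a)

section Dilation

variable {S : Type*} [AddCommMonoid S]
  {H : Type*} [NormedAddCommGroup H] [InnerProductSpace ℂ H] [CompleteSpace H]
  {K : Type*} [NormedAddCommGroup K] [InnerProductSpace ℂ K] [CompleteSpace K]

instance CpSemigroup.instCoeFun {M : VonNeumannAlgebra H} :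
    CoeFun (CpSemigroup S M) (fun _ => S → CompletelyPositiveMap M M) where
  coe Θ := Θ.toMap

/-- An `e`-semigroup is a `cp`-semigroup that consists of `⋆`-endomorphisms
(not necessarily unital). -/
def CpSemigroup.IsESemigroup {M : VonNeumannAlgebra H} (α : CpSemigroup S M) : Prop :=
  ∀ s, (∀ a b, α s (a * b) = α s a * α s b) ∧ ∀ a, α s (star a) = star (α s a)

/-- The compression `a ↦ u⋆ a u` along an isometry `u : H → K`. -/
def compress (u : H →ₗᵢ[ℂ] K) (a : K →L[ℂ] K) : H →L[ℂ] H :=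
  adjoint u.toContinuousLinearMap ∘L a ∘L u.toContinuousLinearMap

/-- The map `x ↦ u x u⋆` along an isometry `u : H → K`. -/
def inflate (u : H →ₗᵢ[ℂ] K) (x : H →L[ℂ] H) : K →L[ℂ] K :=
  u.toContinuousLinearMap ∘L x ∘L adjoint u.toContinuousLinearMap

/-- `(K, u, R, α)` is an `e`-dilation of the `cp`-semigroup `Θ` on `M`: `α` is an `e`-semigroup on
`R`, `u⋆ R u = M`, and `Θ s (u⋆ a u) = u⋆ (α s a) u` for all `a` in `R`. -/
structure IsEDilation {M : VonNeumannAlgebra H} (Θ : CpSemigroup S M) (u : H →ₗᵢ[ℂ] K)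
    (R : VonNeumannAlgebra K) (α : CpSemigroup S R) : Prop where
  isESemigroup : α.IsESemigroup
  image_compress : compress u '' (R : Set (K →L[ℂ] K)) = (M : Set (H →L[ℂ] H))
  map_compress : ∀ (s : S) (a : R) (x : M), (x : H →L[ℂ] H) = compress u a →
    (Θ s x : H →L[ℂ] H) = compress u (α s a)

/-- An `e`-dilation `(K, u, R, α)` is minimal if the projection `u u⋆` (which belongs to `R`) has
central support `1` in `R`, and `R` is the von Neumann algebra generated by the sets
`α s (u M u⋆)`. -/
structure IsMinimalEDilation {M : VonNeumannAlgebra H} (Θ : CpSemigroup S M) (u : H →ₗᵢ[ℂ] K)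
    (R : VonNeumannAlgebra K) (α : CpSemigroup S R) : Prop extends IsEDilation Θ u R α where
  range_mem : inflate u 1 ∈ R
  centralSupport : R.IsCentralSupport (inflate u 1) 1
  generates : R.IsGeneratedBy
    {y | ∃ (s : S) (a : R), (∃ x ∈ M, (a : K →L[ℂ] K) = inflate u x) ∧ y = α s a}

end Dilation

end

/-! The semigroup consists of the conjugations by the monomials in three commuting contractions
`T i` on `ℂ ⊕ (ℂ² ⊕ ℂ²)`: the identity on the first summand, and Parrott's contractions, which have
no commuting isometric dilations, on the second.

Suppose that `α` is an `e`-dilation on `B(K)` along `u`. Let `e` be the unit vector of the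
one-dimensional summand, so that `(T ^ n)⋆ e = e` for all `n`, and put `k = u e`. Since each `α n`
is multiplicative, `V n x = α n (|x⟩⟨k|) k` satisfies
`⟨V n x, V n y⟩ = ⟨x, y⟩ ⟨k, α n (|k⟩⟨k|) k⟩`, and the last factor is `|⟨e, T ^ n e⟩|² = 1`. So each `V n`
is an isometry. Moreover `u⋆ V n = T ^ n u⋆`
by the dilation property, and `V m V n = V (m + n)` because the projection `α m (|k⟩⟨k|)` fixes `k`.
The `V n` at the three generators of `ℕ³` are therefore commuting isometric dilations of the `T i`
(`IsEDilation.exists_isometric_dilation`), which do not exist (`parrott_no_isometric_dilation`).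

A minimal `e`-dilation to `R` reduces to this case, because then `R = B(K)`
(`VonNeumannAlgebra.eq_full_of_centralSupport`): the corner of `R` at `u u⋆` is `u B(H) u⋆`, so
elements of the commutant `R'` act as scalars on the range of `u`, and, as `u u⋆` has central
support `1`, on all of `K`.

The conjugations form a `cp`-semigroup by `CpSemigroup.ofConj`. As `H` has finite dimension, their
normality follows from the compactness of balls, which makes suprema of bounded directed sets norm
limits. -/

noncomputable section

/-! ### Semigroups of conjugations -/

/-- If closed balls are compact, then the supremum of a directed set of positive elements is a norm
limit of elements of the set: a cluster point of the set, viewed as a bounded increasing net, is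
another supremum. -/
theorem IsLUB.mem_closure_of_directedOn {A : Type*} [CStarAlgebra A] [PartialOrder A]
    [StarOrderedRing A] [ProperSpace A] {D : Set A} {a : A} (hne : D.Nonempty)
    (hdir : DirectedOn (· ≤ ·) D) (hpos : ∀ d ∈ D, 0 ≤ d) (ha : IsLUB D a) : a ∈ closure D := by
  have : Nonempty D := hne.to_subtype
  have : IsDirectedOrder D := ⟨directedOn_iff_directed.mp hdir⟩
  let F : Filter A := Filter.map Subtype.val (Filter.atTop : Filter D)
  have hmem : ∀ (c : A), ClusterPt c F → ∀ s : Set A, IsClosed s → s ∈ F → c ∈ s := by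
    intro c hc s hs hsF
    rw [← hs.closure_eq]
    exact mem_closure_iff_clusterPt.mpr (hc.mono (Filter.le_principal_iff.mpr hsF))
  have hball : F ≤ Filter.principal (Metric.closedBall 0 ‖a‖) := by
    refine Filter.le_principal_iff.mpr (Filter.mem_map.mpr (Filter.univ_mem' fun d => ?_))
    simpa using CStarAlgebra.norm_le_norm_of_nonneg_of_le (hpos d d.2) (ha.1 d.2)
  obtain ⟨c, -, hc⟩ := (isCompact_closedBall (0 : A) ‖a‖).exists_clusterPt hball
  have hcD : c ∈ closure D :=
    hmem c hc _ isClosed_closure (Filter.mem_map.mpr (Filter.univ_mem' fun d => subset_closure d.2))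
  have hca : IsLUB D c := by
    refine ⟨fun d hd => ?_, fun b hb => ?_⟩
    · exact hmem c hc _ isClosed_Ici
        (Filter.mem_map.mpr (Filter.mem_atTop (⟨d, hd⟩ : D)))
    · exact hmem c hc _ isClosed_Iic (Filter.mem_map.mpr (Filter.univ_mem' fun d => hb d.2))
  rwa [ha.unique hca]

/-- Over a finite-dimensional Hilbert space, continuity in norm is enough for normality. -/
theorem VonNeumannAlgebra.isNormalMap_of_continuous {H : Type*} [NormedAddCommGroup H]
    [InnerProductSpace ℂ H] [CompleteSpace H] [FiniteDimensional ℂ H] {M : VonNeumannAlgebra H}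
    {φ : M → M} (hc : Continuous φ) (hm : Monotone φ) : VonNeumannAlgebra.IsNormalMap φ := by
  intro D hne hdir hpos a ha
  have : ProperSpace (H →L[ℂ] H) := FiniteDimensional.proper ℂ _
  have : ProperSpace M := ProperSpace.of_isClosed (VonNeumannAlgebra.instIsClosedCoe M)
  have h := ha.mem_closure_of_directedOn hne hdir hpos
  refine ⟨hm.mem_upperBounds_image ha.1, fun b hb => ?_⟩
  exact closure_minimal hb isClosed_Iic (image_closure_subset_closure_image hc ⟨a, h, rfl⟩)

/-- The map `a ↦ t a t⋆` on a C⋆-algebra, as a completely positive map. Its amplification to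
matrices is the conjugation by the diagonal matrix with entries `t`. -/
def CompletelyPositiveMap.conj {A : Type*} [CStarAlgebra A] [PartialOrder A] [StarOrderedRing A]
    (t : A) : CompletelyPositiveMap A A where
  toLinearMap := (LinearMap.mulLeft ℂ t).comp (LinearMap.mulRight ℂ (star t))
  map_cstarMatrix_nonneg' k M hM := by
    let d : CStarMatrix (Fin k) (Fin k) A := CStarMatrix.ofMatrix (Matrix.diagonal fun _ => t)
    have hd : star d = CStarMatrix.ofMatrix (Matrix.diagonal fun _ => star t) :=
      Matrix.diagonal_conjTranspose _
    have h := star_right_conjugate_nonneg hM d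
    convert h using 1
    ext i j
    have e : (d * M * star d) i j = t * M i j * star t := by
      rw [hd]
      exact (Matrix.mul_diagonal _ _ _ _).trans
        (congrArg (· * star t) (Matrix.diagonal_mul _ _ _ _))
    rw [e]
    simp [mul_assoc]

theorem CompletelyPositiveMap.conj_apply {A : Type*} [CStarAlgebra A] [PartialOrder A]
    [StarOrderedRing A] (t a : A) : CompletelyPositiveMap.conj t a = t * a * star t :=
  (mul_assoc _ _ _).symm

/-- The `cp`-semigroup `a ↦ t s * a * star (t s)` given by a multiplicative family of contractions
`t s` in a von Neumann algebra on a finite-dimensional Hilbert space. -/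
def CpSemigroup.ofConj {S : Type*} [AddCommMonoid S] {H : Type*} [NormedAddCommGroup H]
    [InnerProductSpace ℂ H] [CompleteSpace H] [FiniteDimensional ℂ H] {M : VonNeumannAlgebra H}
    (t : S → M) (hnorm : ∀ s, ‖t s‖ ≤ 1) (hzero : t 0 = 1)
    (hadd : ∀ s r, t (s + r) = t s * t r) : CpSemigroup S M where
  toMap s := CompletelyPositiveMap.conj (t s)
  contractive' s a := by
    rw [CompletelyPositiveMap.conj_apply]
    calc ‖t s * a * star (t s)‖ ≤ ‖t s‖ * ‖a‖ * ‖t s‖ := by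
          rw [← norm_star (t s)]
          nth_rewrite 1 [norm_star]
          exact norm_mul₃_le
      _ ≤ 1 * ‖a‖ * 1 := by gcongr <;> exact hnorm s
      _ = ‖a‖ := by ring
  normal' s := by
    refine VonNeumannAlgebra.isNormalMap_of_continuous ?_ (OrderHomClass.mono _)
    exact (continuous_const.mul continuous_id).mul continuous_const |>.congr fun a =>
      (CompletelyPositiveMap.conj_apply (t s) a).symm
  map_zero' a := by simp [CompletelyPositiveMap.conj_apply, hzero]
  map_add' s r a := by simp [CompletelyPositiveMap.conj_apply, hadd, mul_assoc]

/-! ### Von Neumann algebras of minimal dilations -/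

/-- An operator that commutes with all operators of rank one is a scalar. -/
theorem exists_eq_smul_of_commute_rankOne {H : Type*} [NormedAddCommGroup H]
    [InnerProductSpace ℂ H] (c : H →L[ℂ] H)
    (hc : ∀ x y : H, Commute c (InnerProductSpace.rankOne ℂ x y)) : ∃ μ : ℂ, ∀ x, c x = μ • x := by
  rcases subsingleton_or_nontrivial H with h | h
  · exact ⟨0, fun x => Subsingleton.elim _ _⟩
  obtain ⟨y, hy⟩ := exists_norm_eq H zero_le_one
  refine ⟨inner ℂ y (c y), fun x => ?_⟩
  have h1 := DFunLike.congr_fun (hc x y).eq y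
  simpa [hy, inner_self_eq_norm_sq_to_K] using h1

section MinimalDilation

variable {H : Type*} [NormedAddCommGroup H] [InnerProductSpace ℂ H] [CompleteSpace H]
  {K : Type*} [NormedAddCommGroup K] [InnerProductSpace ℂ K] [CompleteSpace K]

theorem compress_apply (u : H →ₗᵢ[ℂ] K) (a : K →L[ℂ] K) (x : H) :
    compress u a x = adjoint u.toContinuousLinearMap (a (u x)) := rfl

theorem inflate_apply (u : H →ₗᵢ[ℂ] K) (a : H →L[ℂ] H) (x : K) :
    inflate u a x = u (a (adjoint u.toContinuousLinearMap x)) := rfl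

theorem LinearIsometry.adjoint_apply_self (u : H →ₗᵢ[ℂ] K) (x : H) :
    adjoint u.toContinuousLinearMap (u x) = x := by
  refine ext_inner_right ℂ fun y => ?_
  rw [adjoint_inner_left]
  exact u.inner_map_map x y

/-- If `u⋆ R u` is all of `B(H)`, and `u u⋆` is a projection in `R` with central support `1`, then
`R` is all of `B(K)`. -/
theorem VonNeumannAlgebra.eq_full_of_centralSupport {R : VonNeumannAlgebra K} (u : H →ₗᵢ[ℂ] K)
    (hp : inflate u 1 ∈ R) (hz : R.IsCentralSupport (inflate u 1) 1)
    (hu : compress u '' (R : Set (K →L[ℂ] K)) = (VonNeumannAlgebra.full H : Set (H →L[ℂ] H))) :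
    R = VonNeumannAlgebra.full K := by
  have hadj := LinearIsometry.adjoint_apply_self u
  have hinfl : ∀ x : H →L[ℂ] H, inflate u x ∈ R := by
    intro x
    obtain ⟨r, hr, hrx⟩ : x ∈ compress u '' (R : Set (K →L[ℂ] K)) := hu ▸ trivial
    have : inflate u x = inflate u 1 * r * inflate u 1 := by
      ext k
      simp [inflate_apply, ← hrx, compress_apply]
    rw [this]
    exact mul_mem (mul_mem hp hr) hp
  -- An element of `R'` commutes with `u B(H) u⋆`, so it acts on the range of `u` as a scalar.
  have hscal : ∀ y ∈ R.commutant, ∃ μ : ℂ, ∀ h, y (u h) = μ • u h := by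
    intro y hy
    rw [VonNeumannAlgebra.mem_commutant_iff] at hy
    have hcomm : ∀ (x : H →L[ℂ] H) (h : H), y (u (x h)) = inflate u x (y (u h)) := by
      intro x h
      have := DFunLike.congr_fun (hy _ (hinfl x)) (u h)
      simpa [inflate_apply, hadj] using this.symm
    obtain ⟨μ, hμ⟩ := exists_eq_smul_of_commute_rankOne (compress u y) (by
      intro a b
      ext h
      have := congrArg (adjoint u.toContinuousLinearMap)
        (hcomm (InnerProductSpace.rankOne ℂ a b) h)
      rw [inflate_apply, hadj] at this
      exact this)
    refine ⟨μ, fun h => ?_⟩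
    have h1 := hcomm 1 h
    rw [inflate_apply] at h1
    rw [← map_smul, ← hμ h]
    exact h1
  -- `W` is the common kernel of the elements of `R'` that vanish on the range of `u`. Its
  -- projection is central and dominates `u u⋆`, so `W` is the whole space.
  let W : Submodule ℂ K := ⨅ y : {y : K →L[ℂ] K // y ∈ R.commutant ∧ ∀ h, y (u h) = 0}, y.1.ker
  have hW : ∀ w, w ∈ W ↔ ∀ y ∈ R.commutant, (∀ h, y (u h) = 0) → y w = 0 := by
    intro w
    simp [W, Submodule.mem_iInf]
  have hWc : IsClosed (W : Set K) := by
    rw [Submodule.coe_iInf]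
    exact isClosed_iInter fun y => y.1.isClosed_ker
  have : CompleteSpace W := hWc.completeSpace_coe
  have hq : IsStarProjection W.starProjection := isStarProjection_starProjection
  have htop : 1 ≤ W.starProjection := by
    refine hz.2 ⟨hq, ?_, ?_, ?_⟩
    · rw [VonNeumannAlgebra.IsStarProjection.mem_iff hq]
      intro y' hy'
      rw [Submodule.range_starProjection, Module.End.mem_invtSubmodule]
      intro w hw
      change y' w ∈ W
      rw [hW] at hw ⊢
      intro y hy hyu
      obtain ⟨μ, hμ⟩ := hscal y' hy'
      exact hw (y * y') (mul_mem hy hy') fun h => by simp [hμ, hyu]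
    · rw [VonNeumannAlgebra.IsStarProjection.mem_iff hq]
      intro r hr
      rw [VonNeumannAlgebra.commutant_commutant] at hr
      rw [Submodule.range_starProjection, Module.End.mem_invtSubmodule]
      intro w hw
      change r w ∈ W
      rw [hW] at hw ⊢
      intro y hy hyu
      have h2 := DFunLike.congr_fun (VonNeumannAlgebra.mem_commutant_iff.mp hy r hr) w
      change r (y w) = y (r w) at h2
      rw [hw y hy hyu, map_zero] at h2
      exact h2.symm
    · ext k
      refine Submodule.starProjection_eq_self_iff.mpr ((hW _).mpr fun y _ hyu => ?_)
      exact hyu _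
  have hWtop : ∀ w, w ∈ W := by
    intro w
    rw [← Submodule.starProjection_eq_self_iff, le_antisymm hq.le_one htop]
    rfl
  -- Hence an element of `R'` that acts on the range of `u` as a scalar is that scalar.
  rw [← R.commutant_commutant]
  refine VonNeumannAlgebra.ext fun x => ⟨fun _ => trivial, fun _ => ?_⟩
  rw [VonNeumannAlgebra.mem_commutant_iff]
  intro y hy
  obtain ⟨μ, hμ⟩ := hscal y hy
  have hy' : ∀ w, y w = μ • w := by
    intro w
    have := (hW w).mp (hWtop w) (y - μ • 1) (sub_mem hy (SMulMemClass.smul_mem μ (one_mem _)))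
      fun h => by simp [hμ]
    simpa [sub_eq_zero] using this
  ext w
  simp [hy']

end MinimalDilation

/-! ### Dilations to all bounded operators yield isometric dilations -/

section Dilation

open InnerProductSpace

variable {S : Type*} [AddCommMonoid S]
  {H : Type*} [NormedAddCommGroup H] [InnerProductSpace ℂ H] [CompleteSpace H]
  {K : Type*} [NormedAddCommGroup K] [InnerProductSpace ℂ K] [CompleteSpace K]

theorem compress_rankOne (u : H →ₗᵢ[ℂ] K) (x y : K) :
    compress u (rankOne ℂ x y) =
      rankOne ℂ (adjoint u.toContinuousLinearMap x) (adjoint u.toContinuousLinearMap y) := by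
  rw [compress, rankOne_comp, comp_rankOne]

variable {Θ : CpSemigroup S (VonNeumannAlgebra.full H)} {u : H →ₗᵢ[ℂ] K}
  {α : CpSemigroup S (VonNeumannAlgebra.full K)} {t : S → H →L[ℂ] H} {e : H}

/-- A bounded operator, as an element of the von Neumann algebra of all bounded operators. -/
def VonNeumannAlgebra.toFull (a : K →L[ℂ] K) : VonNeumannAlgebra.full K := ⟨a, trivial⟩

open VonNeumannAlgebra (toFull)

/-- The map `x ↦ α s (|x⟩⟨k|) k`. For an endomorphism `α s` and a unit vector `k` in the range of
the projection `α s (|k⟩⟨k|)`, it is an isometry that intertwines each `b` with `α s b`. -/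
def CpSemigroup.implement (α : CpSemigroup S (VonNeumannAlgebra.full K)) (k : K) (s : S) :
    K →ₗ[ℂ] K where
  toFun x := (α s (toFull (rankOne ℂ x k)) : K →L[ℂ] K) k
  map_add' x y := by
    have h : toFull (rankOne ℂ (x + y) k) = toFull (rankOne ℂ x k) + toFull (rankOne ℂ y k) :=
      Subtype.ext (by rw [map_add]; rfl)
    rw [h, map_add]
    rfl
  map_smul' c x := by
    have h : toFull (rankOne ℂ (c • x) k) = c • toFull (rankOne ℂ x k) :=
      Subtype.ext (by rw [map_smul]; rfl)
    rw [h, map_smul]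
    rfl

theorem CpSemigroup.implement_apply (α : CpSemigroup S (VonNeumannAlgebra.full K)) (k : K) (s : S)
    (x : K) : α.implement k s x = (α s (toFull (rankOne ℂ x k)) : K →L[ℂ] K) k := rfl

theorem IsEDilation.compress_apply_of_conj (h : IsEDilation Θ u (VonNeumannAlgebra.full K) α)
    (hΘ : ∀ s a, (Θ s a : H →L[ℂ] H) = t s * a * star (t s)) (s : S) (a : K →L[ℂ] K) :
    compress u (α s (toFull a)) = t s * compress u a * star (t s) := by
  rw [← h.map_compress s (toFull a) (toFull (compress u a)) rfl, hΘ]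
  rfl

theorem IsEDilation.adjoint_implement (h : IsEDilation Θ u (VonNeumannAlgebra.full K) α)
    (hΘ : ∀ s a, (Θ s a : H →L[ℂ] H) = t s * a * star (t s)) (he : ‖e‖ = 1)
    (hte : ∀ s, star (t s) e = e) (s : S) (x : K) :
    adjoint u.toContinuousLinearMap (α.implement (u e) s x) =
      t s (adjoint u.toContinuousLinearMap x) := by
  have := DFunLike.congr_fun (h.compress_apply_of_conj hΘ s (rankOne ℂ x (u e))) e
  rw [compress_rankOne, LinearIsometry.adjoint_apply_self] at this
  refine Eq.trans this ?_
  simp [hte, he, inner_self_eq_norm_sq_to_K]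

theorem IsEDilation.inner_implement_self (h : IsEDilation Θ u (VonNeumannAlgebra.full K) α)
    (hΘ : ∀ s a, (Θ s a : H →L[ℂ] H) = t s * a * star (t s)) (he : ‖e‖ = 1)
    (hte : ∀ s, star (t s) e = e) (s : S) :
    inner ℂ (u e) (α.implement (u e) s (u e)) = 1 := by
  change inner ℂ (u.toContinuousLinearMap e) _ = _
  rw [← adjoint_inner_right, h.adjoint_implement hΘ he hte, LinearIsometry.adjoint_apply_self,
    ← adjoint_inner_left, ← star_eq_adjoint, hte, inner_self_eq_norm_sq_to_K, he]
  simp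

theorem IsEDilation.inner_implement (h : IsEDilation Θ u (VonNeumannAlgebra.full K) α)
    (hΘ : ∀ s a, (Θ s a : H →L[ℂ] H) = t s * a * star (t s)) (he : ‖e‖ = 1)
    (hte : ∀ s, star (t s) e = e) (s : S) (x y : K) :
    inner ℂ (α.implement (u e) s x) (α.implement (u e) s y) = inner ℂ x y := by
  have h1 : star (toFull (rankOne ℂ x (u e))) * toFull (rankOne ℂ y (u e)) =
      (inner ℂ x y : ℂ) • toFull (rankOne ℂ (u e) (u e)) := by
    refine Subtype.ext ?_
    change adjoint (rankOne ℂ x (u e)) ∘L rankOne ℂ y (u e) = inner ℂ x y • rankOne ℂ (u e) (u e)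
    rw [adjoint_rankOne, rankOne_comp_rankOne]
  have h2 := congrArg (α s) h1
  rw [(h.isESemigroup s).1, (h.isESemigroup s).2, map_smul] at h2
  have h3 : adjoint (α s (toFull (rankOne ℂ x (u e))) : K →L[ℂ] K) (α.implement (u e) s y) =
      inner ℂ x y • α.implement (u e) s (u e) :=
    DFunLike.congr_fun (congrArg Subtype.val h2) (u e)
  rw [α.implement_apply (u e) s x, ← adjoint_inner_right, h3, inner_smul_right,
    h.inner_implement_self hΘ he hte, mul_one]

/-- The unit vector `u e` lies in the range of the projection `α s (|u e⟩⟨u e|)`. -/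
theorem IsEDilation.implement_self (h : IsEDilation Θ u (VonNeumannAlgebra.full K) α)
    (hΘ : ∀ s a, (Θ s a : H →L[ℂ] H) = t s * a * star (t s)) (he : ‖e‖ = 1)
    (hte : ∀ s, star (t s) e = e) (s : S) : α.implement (u e) s (u e) = u e := by
  have hu : ‖u e‖ = 1 := by rw [u.norm_map, he]
  have hV : ‖α.implement (u e) s (u e)‖ = 1 := by
    rw [norm_eq_sqrt_re_inner (𝕜 := ℂ), h.inner_implement hΘ he hte, ← norm_eq_sqrt_re_inner, hu]
  exact ((inner_eq_one_iff_of_norm_eq_one hu hV).mp (h.inner_implement_self hΘ he hte s)).symm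

/-- The implementing isometries form a semigroup, because
`|V r x⟩⟨k| = α r (|x⟩⟨k|) |k⟩⟨k|` for `k = u e`, and `α s (|k⟩⟨k|)` fixes `k`. -/
theorem IsEDilation.implement_add (h : IsEDilation Θ u (VonNeumannAlgebra.full K) α)
    (hΘ : ∀ s a, (Θ s a : H →L[ℂ] H) = t s * a * star (t s)) (he : ‖e‖ = 1)
    (hte : ∀ s, star (t s) e = e) (s r : S) (x : K) :
    α.implement (u e) (s + r) x = α.implement (u e) s (α.implement (u e) r x) := by
  have h1 : toFull (rankOne ℂ (α.implement (u e) r x) (u e)) =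
      α r (toFull (rankOne ℂ x (u e))) * toFull (rankOne ℂ (u e) (u e)) :=
    Subtype.ext (comp_rankOne _ _ _).symm
  rw [α.implement_apply _ s, h1, (h.isESemigroup s).1, ← α.map_add']
  change _ = (α (s + r) (toFull (rankOne ℂ x (u e))) : K →L[ℂ] K) (α.implement (u e) s (u e))
  rw [h.implement_self hΘ he hte]
  rfl

/-- Suppose that `Θ s` is the conjugation by `t s`, and that all `(t s)⋆` fix one unit vector `e`.
Then an `e`-dilation of `Θ` to `B(K)` yields a semigroup of isometries on `K` that dilates `t`. -/
theorem IsEDilation.exists_isometric_dilation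
    (h : IsEDilation Θ u (VonNeumannAlgebra.full K) α)
    (hΘ : ∀ s a, (Θ s a : H →L[ℂ] H) = t s * a * star (t s)) (he : ‖e‖ = 1)
    (hte : ∀ s, star (t s) e = e) :
    ∃ V : S → K →ₗᵢ[ℂ] K, (∀ s r x, V (s + r) x = V s (V r x)) ∧
      ∀ s x, adjoint u.toContinuousLinearMap (V s x) = t s (adjoint u.toContinuousLinearMap x) :=
  ⟨fun s => (α.implement (u e) s).isometryOfInner (h.inner_implement hΘ he hte s),
    h.implement_add hΘ he hte, h.adjoint_implement hΘ he hte⟩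

end Dilation

/-- An isometric dilation of `t` extends `t` on the vectors whose norm `t` preserves: the component
of `V (u x)` in the range of `u` is `u (t x)`, which already has full norm. -/
theorem LinearIsometry.map_of_norm_map_eq {H K : Type*} [NormedAddCommGroup H]
    [InnerProductSpace ℂ H] [CompleteSpace H] [NormedAddCommGroup K] [InnerProductSpace ℂ K]
    [CompleteSpace K] {u : H →ₗᵢ[ℂ] K} {V : K →ₗᵢ[ℂ] K} {t : H →L[ℂ] H}
    (hV : ∀ x, adjoint u.toContinuousLinearMap (V x) = t (adjoint u.toContinuousLinearMap x))
    {x : H} (hx : ‖t x‖ = ‖x‖) : V (u x) = u (t x) := by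
  have h1 : inner ℂ (u (t x)) (V (u x)) = (‖x‖ : ℂ) ^ 2 := by
    change inner ℂ (u.toContinuousLinearMap (t x)) _ = _
    rw [← adjoint_inner_right, hV, LinearIsometry.adjoint_apply_self, inner_self_eq_norm_sq_to_K,
      hx]
    rfl
  rw [← sub_eq_zero, ← norm_eq_zero, ← sq_eq_zero_iff, @norm_sub_sq ℂ, ← inner_conj_symm, h1,
    V.norm_map, u.norm_map, u.norm_map, hx]
  norm_cast
  simp only [Complex.conj_ofReal, RCLike.re_eq_complex_re, Complex.ofReal_re]
  ring

/-! ### Parrott's contractions with an identity summand -/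

/-- The matrices of `1 ⊕ N U` on `ℂ ⊕ (ℂ² ⊕ ℂ²)`, where `N U` maps `(x, y)` to `(0, U x)` and `U` is
the identity, `diag(1, -1)` or the flip of the two coordinates. -/
def parrottMatrix : Fin 3 → Matrix (Fin 5) (Fin 5) ℂ :=
  ![!![1, 0, 0, 0, 0; 0, 0, 0, 0, 0; 0, 0, 0, 0, 0; 0, 1, 0, 0, 0; 0, 0, 1, 0, 0],
    !![1, 0, 0, 0, 0; 0, 0, 0, 0, 0; 0, 0, 0, 0, 0; 0, 1, 0, 0, 0; 0, 0, -1, 0, 0],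
    !![1, 0, 0, 0, 0; 0, 0, 0, 0, 0; 0, 0, 0, 0, 0; 0, 0, 1, 0, 0; 0, 1, 0, 0, 0]]

/-- Three commuting contractions: Parrott's example on `ℂ² ⊕ ℂ²`, with a one-dimensional identity
summand adjoined, so that no product of them vanishes and `e₀` is a common fixed vector. -/
def parrott (i : Fin 3) : EuclideanSpace ℂ (Fin 5) →L[ℂ] EuclideanSpace ℂ (Fin 5) :=
  Matrix.toEuclideanCLM (n := Fin 5) (𝕜 := ℂ) (parrottMatrix i)

theorem parrott_apply (i : Fin 3) (x : EuclideanSpace ℂ (Fin 5)) :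
    parrott i x =
      ![!₂[x 0, 0, 0, x 1, x 2], !₂[x 0, 0, 0, x 1, -x 2], !₂[x 0, 0, 0, x 2, x 1]] i := by
  ext j
  change (parrottMatrix i).mulVec x.ofLp j = _
  fin_cases i <;> fin_cases j <;>
    simp [parrottMatrix, Matrix.mulVec, dotProduct, Fin.sum_univ_five]

theorem commute_parrott (i j : Fin 3) : Commute (parrott i) (parrott j) := by
  ext x k
  change parrott i (parrott j x) k = parrott j (parrott i x) k
  simp only [parrott_apply]
  fin_cases i <;> fin_cases j <;> fin_cases k <;> simp

theorem norm_parrott_le_one (i : Fin 3) : ‖parrott i‖ ≤ 1 := by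
  refine opNorm_le_bound _ zero_le_one fun x => ?_
  rw [one_mul, ← sq_le_sq₀ (norm_nonneg _) (norm_nonneg _), EuclideanSpace.norm_sq_eq,
    EuclideanSpace.norm_sq_eq, parrott_apply]
  fin_cases i <;> simp [Fin.sum_univ_five] <;> nlinarith [sq_nonneg ‖x 3‖, sq_nonneg ‖x 4‖]

theorem star_parrott_apply (i : Fin 3) :
    star (parrott i) (EuclideanSpace.single 0 1) = EuclideanSpace.single 0 1 := by
  rw [parrott, ← map_star]
  ext j
  change (star (parrottMatrix i)).mulVec (Pi.single 0 1) j = _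
  fin_cases i <;> fin_cases j <;>
    simp [parrottMatrix, Matrix.star_apply]

/-- The operator `T₀ ^ n₀ * T₁ ^ n₁ * T₂ ^ n₂` for the contractions `T = parrott`. -/
def parrottMonomial (n : Fin 3 → ℕ) :
    EuclideanSpace ℂ (Fin 5) →L[ℂ] EuclideanSpace ℂ (Fin 5) :=
  parrott 0 ^ n 0 * parrott 1 ^ n 1 * parrott 2 ^ n 2

theorem parrottMonomial_single (i : Fin 3) : parrottMonomial (Pi.single i 1) = parrott i := by
  fin_cases i <;> simp [parrottMonomial]

theorem parrottMonomial_add (m n : Fin 3 → ℕ) :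
    parrottMonomial (m + n) = parrottMonomial m * parrottMonomial n := by
  have h (i j : Fin 3) (k l : ℕ) : Commute (parrott i ^ k) (parrott j ^ l) :=
    (commute_parrott i j).pow_pow k l
  simp only [parrottMonomial, Pi.add_apply, pow_add]
  rw [((h 2 0 _ _).mul_right (h 2 1 _ _)).mul_mul_mul_comm,
    (h 1 0 _ _).mul_mul_mul_comm]

theorem norm_parrottMonomial_le_one (n : Fin 3 → ℕ) : ‖parrottMonomial n‖ ≤ 1 := by
  have h (i : Fin 3) (k : ℕ) : ‖parrott i ^ k‖ ≤ 1 :=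
    (norm_pow_le _ k).trans (pow_le_one₀ (norm_nonneg _) (norm_parrott_le_one i))
  have h01 := (norm_mul_le _ _).trans (mul_le_one₀ (h 0 (n 0)) (norm_nonneg _) (h 1 (n 1)))
  exact (norm_mul_le _ _).trans (mul_le_one₀ h01 (norm_nonneg _) (h 2 (n 2)))

theorem star_parrottMonomial_apply (n : Fin 3 → ℕ) :
    star (parrottMonomial n) (EuclideanSpace.single 0 1) = EuclideanSpace.single 0 1 := by
  have h (i : Fin 3) : star (parrott i) ∈ MulAction.stabilizerSubmonoid
      (EuclideanSpace ℂ (Fin 5) →L[ℂ] EuclideanSpace ℂ (Fin 5))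
      (EuclideanSpace.single 0 1 : EuclideanSpace ℂ (Fin 5)) := star_parrott_apply i
  have hn : star (parrottMonomial n) ∈ MulAction.stabilizerSubmonoid
      (EuclideanSpace ℂ (Fin 5) →L[ℂ] EuclideanSpace ℂ (Fin 5))
      (EuclideanSpace.single 0 1 : EuclideanSpace ℂ (Fin 5)) := by
    simp only [parrottMonomial, star_mul, star_pow]
    exact mul_mem (pow_mem (h 2) _) (mul_mem (pow_mem (h 1) _) (pow_mem (h 0) _))
  exact hn

/-- The `cp`-semigroup over `ℕ³` of conjugations by the monomials in `parrott`. -/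
def parrottSemigroup :
    CpSemigroup (Fin 3 → ℕ) (VonNeumannAlgebra.full (EuclideanSpace ℂ (Fin 5))) :=
  CpSemigroup.ofConj (fun n => VonNeumannAlgebra.toFull (parrottMonomial n))
    norm_parrottMonomial_le_one (Subtype.ext (by simp [VonNeumannAlgebra.toFull, parrottMonomial]))
    fun m n => Subtype.ext (parrottMonomial_add m n)

theorem parrottSemigroup_apply (n : Fin 3 → ℕ)
    (a : VonNeumannAlgebra.full (EuclideanSpace ℂ (Fin 5))) :
    (parrottSemigroup n a : EuclideanSpace ℂ (Fin 5) →L[ℂ] EuclideanSpace ℂ (Fin 5)) =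
      parrottMonomial n * a * star (parrottMonomial n) :=
  congrArg Subtype.val (CompletelyPositiveMap.conj_apply
    (VonNeumannAlgebra.toFull (parrottMonomial n)) a)

section NoDilation

variable {K : Type*} [NormedAddCommGroup K] [InnerProductSpace ℂ K] [CompleteSpace K]

/-- On the first copy of `ℂ²` the operators preserve norms, so commuting isometries that dilate them
extend them there, and then they can commute only if the unitaries `U` do. But `diag(1, -1)` and the
flip anticommute. -/
theorem parrott_no_isometric_dilation (u : EuclideanSpace ℂ (Fin 5) →ₗᵢ[ℂ] K)
    (V : Fin 3 → K →ₗᵢ[ℂ] K) (hcomm : ∀ i j x, V i (V j x) = V j (V i x))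
    (hV : ∀ i x, adjoint u.toContinuousLinearMap (V i x) =
      parrott i (adjoint u.toContinuousLinearMap x)) : False := by
  let e (k : Fin 5) : EuclideanSpace ℂ (Fin 5) := EuclideanSpace.single k 1
  have hne (k : Fin 5) : ‖e k‖ = 1 := by simp [e]
  have key (i : Fin 3) (k l : Fin 5) (c : ℂ) (hc : ‖c‖ = 1) (h : parrott i (e k) = c • e l) :
      V i (u (e k)) = c • u (e l) := by
    rw [LinearIsometry.map_of_norm_map_eq (hV i) (by rw [h, norm_smul, hc, hne, hne, one_mul]), h,
      map_smul]
  have h01 := key 0 1 3 1 (by simp) (by ext j; fin_cases j <;> simp [parrott_apply, e])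
  have h02 := key 0 2 4 1 (by simp) (by ext j; fin_cases j <;> simp [parrott_apply, e])
  have h11 := key 1 1 3 1 (by simp) (by ext j; fin_cases j <;> simp [parrott_apply, e])
  have h12 := key 1 2 4 (-1) (by simp) (by ext j; fin_cases j <;> simp [parrott_apply, e])
  have h21 := key 2 1 4 1 (by simp) (by ext j; fin_cases j <;> simp [parrott_apply, e])
  simp only [one_smul, neg_smul] at h01 h02 h11 h12 h21
  -- The two sides arise from evaluating the products of `V 0`, `V 1`, `V 2` on the first copy
  -- of `ℂ²` in different orders; `diag(1, -1)` contributes the sign.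
  have h : V 0 (u (e 4)) = -V 0 (u (e 4)) := by
    calc V 0 (u (e 4)) = V 2 (V 0 (u (e 1))) := by rw [← h21, hcomm]
      _ = V 1 (V 2 (u (e 1))) := by rw [h01, ← h11, hcomm]
      _ = V 0 (V 1 (u (e 2))) := by rw [h21, ← h02, hcomm]
      _ = -V 0 (u (e 4)) := by rw [h12, map_neg]
  have h2 : (2 : ℂ) • V 0 (u (e 4)) = 0 := by
    rw [two_smul, ← eq_neg_iff_add_eq_zero]
    exact h
  have h0 : ‖V 0 (u (e 4))‖ = 0 := norm_eq_zero.mpr ((smul_eq_zero.mp h2).resolve_left two_ne_zero)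
  rw [(V 0).norm_map, u.norm_map, hne] at h0
  exact one_ne_zero h0

/-- An `e`-dilation to `B(K)` would yield commuting isometries that dilate `parrott`. -/
theorem parrottSemigroup_not_isEDilation (u : EuclideanSpace ℂ (Fin 5) →ₗᵢ[ℂ] K)
    (α : CpSemigroup (Fin 3 → ℕ) (VonNeumannAlgebra.full K)) :
    ¬ IsEDilation parrottSemigroup u (VonNeumannAlgebra.full K) α := by
  intro h
  obtain ⟨V, hadd, hV⟩ := h.exists_isometric_dilation parrottSemigroup_apply
    (e := EuclideanSpace.single 0 1) (by simp) star_parrottMonomial_apply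
  refine parrott_no_isometric_dilation u (fun i => V (Pi.single i 1)) (fun i j x => ?_)
    fun i x => ?_
  · rw [← hadd, add_comm, hadd]
  · rw [hV, parrottMonomial_single]

end NoDilation

end

theorem mainTheorem3 :
    ∃ (H : Type) (_ : NormedAddCommGroup H) (_ : InnerProductSpace ℂ H) (_ : CompleteSpace H)
      (_ : TopologicalSpace.SeparableSpace H) (T : Fin 3 → H →L[ℂ] H)
      (Θ : CpSemigroup (Fin 3 → ℕ) (VonNeumannAlgebra.full H)),
      (∀ i, ‖T i‖ ≤ 1) ∧
      (∀ i j, Commute (T i) (T j)) ∧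
      (∀ (n : Fin 3 → ℕ) (a : VonNeumannAlgebra.full H),
        (Θ n a : H →L[ℂ] H) =
          (T 0 ^ n 0 * T 1 ^ n 1 * T 2 ^ n 2) * a * star (T 0 ^ n 0 * T 1 ^ n 1 * T 2 ^ n 2)) ∧
      (∀ (K : Type u) [NormedAddCommGroup K] [InnerProductSpace ℂ K] [CompleteSpace K]
        (v : H →ₗᵢ[ℂ] K) (α : CpSemigroup (Fin 3 → ℕ) (VonNeumannAlgebra.full K)),
        ¬ IsEDilation Θ v (VonNeumannAlgebra.full K) α) ∧
      (∀ (K : Type u) [NormedAddCommGroup K] [InnerProductSpace ℂ K] [CompleteSpace K]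
        (v : H →ₗᵢ[ℂ] K) (R : VonNeumannAlgebra K) (α : CpSemigroup (Fin 3 → ℕ) R),
        ¬ IsMinimalEDilation Θ v R α) := by
  refine ⟨EuclideanSpace ℂ (Fin 5), inferInstance, inferInstance, inferInstance, inferInstance,
    parrott, parrottSemigroup, norm_parrott_le_one, commute_parrott, parrottSemigroup_apply, ?_, ?_⟩
  · intro K _ _ _ v α
    exact parrottSemigroup_not_isEDilation v α
  · intro K _ _ _ v R α h
    obtain rfl := VonNeumannAlgebra.eq_full_of_centralSupport v h.range_mem h.centralSupport
      h.image_compress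
    exact parrottSemigroup_not_isEDilation v α h.toIsEDilation
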